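/- Let $L_2=(\mathbb Z/2)\wr\mathbb Z$ be the lamplighter group. Its elements are lamp stands $g$: a finite set of lit lamps at positions in $\mathbb Z$ together with the position $H(g)\in\mathbb Z$ of the lamplighter. Right multiplication by $a$ toggles the lamp at the lamplighter's position, and right multiplication by $t$ moves the lamplighter from $k$ to $k+1$. Let $d$ be the word metric of the generating set $\{t,at\}$. Let $m(g)$, $M(g)$ be the minimal and maximal position of a lit lamp of $g$, and let $m(f,g)$, $M(f,g)$ be the minimal and maximal position of a lamp whose status differs in $f$ and $g$ (a minimum over the empty set is $+\infty$, a maximum over it is $-\infty$). Put $\iota(z)=d(z,\cdot)-d(z,\mathrm{id})$, let $\overline{L_2}$ be the closure of $\iota(L_2)$ in the real-valued functions on $L_2$ for pointwise convergence (equivalently, uniform convergence on compact sets), call its elements horofunctions, and let $\partial_hL_2=\overline{L_2}\setminus\iota(L_2)$. For a sequence $(g_n)$ in $L_2$, write $h=h_{g_n}$ if $h(x)=\lim_n\big(d(g_n,x)-d(g_n,\mathrm{id})\big)$ for all $x\in L_2$. Call $(g_n)$ left stable if there are $N\in\mathbb N$ and $K\in\mathbb Z$ such that for every $k<K$ the lamp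 at position $k$ has the same status in all $g_n$ with $n>N$; right stable is defined in the same way with $k>K$. A geodesic ray is an isometric embedding $\gamma:\mathbb N\to L_2$. For a geodesic ray $\gamma$ with $\gamma(0)=\mathrm{id}$ and $H(\gamma(n))\to\pm\infty$ in whose points every lamp stabilizes, $m(\gamma),M(\gamma),m(\gamma,g),M(\gamma,g)$ refer to the limiting lamp configuration of $\gamma$. A Busemann point is an element of $\partial_hL_2$ of the form $h_{\gamma(n)}$ for a geodesic ray $\gamma$. Define $$\mathfrak b^{+,\gamma}(g)=2\big(\min\{m(\gamma),0\}-\min\{m(\gamma,g),H(g)\}\big)+H(g),$$ $$\mathfrak b^{-,\gamma}(g)=2\big(\max\{M(\gamma,g)+1,H(g)\}-\max\{M(\gamma)+1,0\}\big)-H(g),$$ $$\mathfrak s^l(g)=|l|-|l-H(g)|\qquad(l\in\mathbb Z),$$ and, for $f\in L_2$ and $l=H(f)$, $$\mathfrak r^{+,f}(g)=2\big(\min\{m(f),l,0\}-\min\{m(f,g),H(g),l\}\big)+\mathfrak s^l(g)\quad\text{if } M(f)<l,$$ $$\mathfrak r^{-,f}(g)=2\big(\max\{M(f,g)+1,H(g),l\}-\max\{M(f)+1,l,0\}\big)+\mathfrak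 s^l(g)\quad\text{if } m(f)\ge l.$$ Theorem. (A) Let $h\in\overline{L_2}$. Then $h=h_{g_n}$ for some sequence $(g_n)$ in $L_2$, and for every such sequence $(H(g_n))$ converges to some $l\in\mathbb Z\cup\{\pm\infty\}$ and: 1. if $l\in\mathbb Z$ and $(g_n)$ is left and right stable, then $(g_n)$ is eventually equal to some $g_0\in L_2$ and $h=\iota(g_0)$, i.e. $h(g)=d(g_0,g)-d(g_0,\mathrm{id})$; 2. if $l=+\infty$ and $(g_n)$ is left stable, then $h=h_{\gamma(n)}=\mathfrak b^{+,\gamma}$ for a geodesic ray $\gamma$ with $\gamma(0)=\mathrm{id}$ and $H(\gamma(n))\to+\infty$, in which every lamp stabilizes and whose limiting set of lit lamps is bounded below; 3. if $l=-\infty$ and $(g_n)$ is right stable, then $h=h_{\gamma(n)}=\mathfrak b^{-,\gamma}$ for a geodesic ray $\gamma$ with $\gamma(0)=\mathrm{id}$ and $H(\gamma(n))\to-\infty$, in which every lamp stabilizes and whose limiting set of lit lamps is bounded above; 4. if $l\in\mathbb Z$ and $(g_n)$ is neither left nor right stable, then $h=\mathfrak s^l$; 5. if $l\in\mathbb Z$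 and $(g_n)$ is left but not right stable, then $h=\mathfrak r^{+,f}$ for some $f\in L_2$ with $M(f)<H(f)=l$; 6. if $l\in\mathbb Z$ and $(g_n)$ is right but not left stable, then $h=\mathfrak r^{-,f}$ for some $f\in L_2$ with $m(f)\ge H(f)=l$; 7. if $l=+\infty$ and $(g_n)$ is not left stable, then $h=H$; 8. if $l=-\infty$ and $(g_n)$ is not right stable, then $h=-H$. (B) Every $h\in\partial_hL_2$ is a Busemann point of the form $h=h_{\gamma(n)}=\mathfrak b^{\pm,\gamma}$ with $\gamma$ as in 2 or 3, or a spine function $\mathfrak s^l$ with $l\in\mathbb Z$, or a rib function $\mathfrak r^{+,f}$ with $M(f)<H(f)$ or $\mathfrak r^{-,f}$ with $m(f)\ge H(f)$, or $H$, or $-H$. The set of points of $\partial_hL_2$ that are not Busemann points is countable. -/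

import Mathlib

open Filter Topology

namespace Lamplighter

/-- The lamplighter group `L₂`, in its lamp stand model: a finite set of lit lamps in a row of lamps
indexed by `ℤ`, together with the position of the lamplighter. -/
@[ext]
structure L2 where
  /-- the positions of the lit lamps -/
  lamps : Finset ℤ
  /-- the position of the lamplighter -/
  height : ℤ

/-- Lamp stands are composed by starting with `g` and then moving and toggling as in `h`, from the
starting position `g.height` instead of `0`. -/
instance : Mul L2 :=
  ⟨fun g h => ⟨symmDiff g.lamps (h.lamps.map (addLeftEmbedding g.height)), g.height + h.height⟩⟩

instance : One L2 := ⟨⟨∅, 0⟩⟩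

instance : Inv L2 := ⟨fun g => ⟨g.lamps.map (addLeftEmbedding (-g.height)), -g.height⟩⟩

theorem mem_lamps_mul (g h : L2) (k : ℤ) :
    k ∈ (g * h).lamps ↔ (k ∈ g.lamps ∧ k - g.height ∉ h.lamps) ∨
      (k - g.height ∈ h.lamps ∧ k ∉ g.lamps) := by
  have key : k ∈ h.lamps.map (addLeftEmbedding g.height) ↔ k - g.height ∈ h.lamps := by
    simp only [Finset.mem_map, addLeftEmbedding_apply]
    constructor
    · rintro ⟨x, hx, rfl⟩
      simpa using hx
    · intro hk
      exact ⟨_, hk, by ring⟩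
  change k ∈ symmDiff g.lamps (h.lamps.map (addLeftEmbedding g.height)) ↔ _
  rw [Finset.mem_symmDiff, key]

theorem height_mul (g h : L2) : (g * h).height = g.height + h.height := rfl

theorem lamps_one : (1 : L2).lamps = ∅ := rfl

theorem height_one : (1 : L2).height = 0 := rfl

theorem mem_lamps_inv (g : L2) (k : ℤ) : k ∈ (g⁻¹).lamps ↔ k + g.height ∈ g.lamps := by
  change k ∈ g.lamps.map (addLeftEmbedding (-g.height)) ↔ _
  simp only [Finset.mem_map, addLeftEmbedding_apply]
  constructor
  · rintro ⟨x, hx, rfl⟩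
    simpa using hx
  · intro hk
    exact ⟨_, hk, by ring⟩

theorem height_inv (g : L2) : (g⁻¹).height = -g.height := rfl

instance : Group L2 :=
  Group.ofLeftAxioms
    (by
      intro x y z
      ext k
      · simp only [mem_lamps_mul, height_mul, sub_sub]
        tauto
      · simp only [height_mul]
        ring)
    (by
      intro x
      ext k
      · simp [mem_lamps_mul, lamps_one, height_one]
      · simp [height_mul, height_one])
    (by
      intro x
      ext k
      · simp [mem_lamps_mul, mem_lamps_inv, height_inv, lamps_one]
      · simp [height_mul, height_inv, height_one])

/-- Right multiplication by `a` toggles the lamp at the lamplighter's position. -/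
def a : L2 := ⟨{0}, 0⟩

/-- Right multiplication by `t` moves the lamplighter one step to the right. -/
def t : L2 := ⟨∅, 1⟩

/-- The generating set `{t, at}`. -/
def gens : Set L2 := {t, a * t}

/-- The word length with respect to the generators `{t, at}` and their inverses. -/
noncomputable def wordLength (g : L2) : ℕ :=
  sInf {n | ∃ w : List L2, w.length = n ∧ (∀ x ∈ w, x ∈ gens ∨ x⁻¹ ∈ gens) ∧ w.prod = g}

/-- The word metric of `{t, at}`, i.e. the Diestel-Leader metric. -/
noncomputable def d (g h : L2) : ℕ := wordLength (g⁻¹ * h)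

/-- Every element is a word in the generators, so that the infimum in `wordLength` is a minimum over
a nonempty set. -/
theorem exists_word (g : L2) :
    ∃ w : List L2, (∀ x ∈ w, x ∈ gens ∨ x⁻¹ ∈ gens) ∧ w.prod = g := by
  have ht : t ∈ Subgroup.closure gens := Subgroup.subset_closure (by simp [gens])
  have hat : a * t ∈ Subgroup.closure gens := Subgroup.subset_closure (by simp [gens])
  have ha : a ∈ Subgroup.closure gens := by
    have := Subgroup.mul_mem _ hat (Subgroup.inv_mem _ ht)
    simpa using this
  have hpow : ∀ n : ℕ, (⟨∅, (n : ℤ)⟩ : L2) ∈ Subgroup.closure gens := by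
    intro n
    induction n with
    | zero => exact Subgroup.one_mem _
    | succ n ih =>
      have := Subgroup.mul_mem _ ih ht
      convert this using 1
      ext k
      · simp [mem_lamps_mul, t]
      · simp [height_mul, t]
  have hz : ∀ n : ℤ, (⟨∅, n⟩ : L2) ∈ Subgroup.closure gens := by
    intro n
    obtain ⟨m, rfl | rfl⟩ := n.eq_nat_or_neg
    · exact hpow m
    · have := Subgroup.inv_mem _ (hpow m)
      convert this using 1
      ext k
      · simp [mem_lamps_inv]
      · simp [height_inv]
  have hlamp : ∀ k : ℤ, (⟨{k}, 0⟩ : L2) ∈ Subgroup.closure gens := by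
    intro k
    have := Subgroup.mul_mem _ (Subgroup.mul_mem _ (hz k) ha) (Subgroup.inv_mem _ (hz k))
    convert this using 1
    ext j
    · simp [mem_lamps_mul, mem_lamps_inv, a, sub_eq_zero]
    · simp [height_mul, height_inv, a]
  have hl : ∀ s : Finset ℤ, (⟨s, 0⟩ : L2) ∈ Subgroup.closure gens := by
    intro s
    induction s using Finset.induction_on with
    | empty => exact hz 0
    | insert k s hk ih =>
      have := Subgroup.mul_mem _ (hlamp k) ih
      convert this using 1
      ext j
      · simp only [mem_lamps_mul, Finset.mem_insert, Finset.mem_singleton, sub_zero]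
        by_cases hj : j = k
        · subst hj
          simp [hk]
        · simp [hj]
      · simp [height_mul]
  have hg : g ∈ Subgroup.closure gens := by
    have := Subgroup.mul_mem _ (hl g.lamps) (hz g.height)
    convert this using 1
    ext j
    · simp [mem_lamps_mul]
    · simp [height_mul]
  rw [← Subgroup.mem_toSubmonoid, Subgroup.closure_toSubmonoid] at hg
  obtain ⟨w, hw, hp⟩ := Submonoid.exists_list_of_mem_closure hg
  exact ⟨w, fun x hx => by simpa using hw x hx, hp⟩

/-- The height function `H`, as a real-valued function on `L₂`. -/
def H (g : L2) : ℝ := (g.height : ℝ)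

/-- `m`: the minimum of a set of lamp positions, `+∞` for the empty set (and `-∞` for a set that is
not bounded below). -/
noncomputable def minPos (S : Set ℤ) : EReal := ⨅ k ∈ S, ((k : ℝ) : EReal)

/-- `M`: the maximum of a set of lamp positions, `-∞` for the empty set (and `+∞` for a set that is
not bounded above). -/
noncomputable def maxPos (S : Set ℤ) : EReal := ⨆ k ∈ S, ((k : ℝ) : EReal)

/-- The embedding of `L₂` in the real-valued functions on `L₂` (all of which are continuous, since
`L₂` is discrete), with the identity as base point. -/
noncomputable def embed (z : L2) : L2 → ℝ := fun x => (d z x : ℝ) - (d z 1 : ℝ)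

/-- The space of horofunctions: the closure of the image of `L₂`. The product topology on `L2 → ℝ` is
the topology of uniform convergence on compact sets, since compact subsets of `L₂` are finite. -/
def horofunctions : Set (L2 → ℝ) := closure (Set.range embed)

/-- The horofunction boundary. -/
def horoboundary : Set (L2 → ℝ) := horofunctions \ Set.range embed

/-- `h` is the horofunction `h_{y_n}` associated to the sequence `y`. -/
def IsHorofunctionOf (y : ℕ → L2) (h : L2 → ℝ) : Prop :=
  ∀ x, Tendsto (fun n => (d (y n) x : ℝ) - (d (y n) 1 : ℝ)) atTop (𝓝 (h x))

/-- A geodesic ray: an isometric embedding of `ℕ`. -/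
def IsGeodesicRay (γ : ℕ → L2) : Prop :=
  ∀ i j : ℕ, (d (γ i) (γ j) : ℤ) = |(i : ℤ) - (j : ℤ)|

/-- A Busemann point: a boundary point that corresponds to the points along a geodesic ray. -/
def IsBusemannPoint (h : L2 → ℝ) : Prop :=
  h ∈ horoboundary ∧ ∃ γ, IsGeodesicRay γ ∧ IsHorofunctionOf γ h

/-- `Λ` is the set of lit lamps of the infinite lamp stand of `γ`: the status of every lamp in `γ n`
is eventually its status in `Λ`. -/
def IsLimitLamps (γ : ℕ → L2) (Λ : Set ℤ) : Prop :=
  ∀ k : ℤ, ∀ᶠ n in atTop, (k ∈ (γ n).lamps ↔ k ∈ Λ)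

/-- `γ` is a geodesic ray from the identity whose class lies in the upper visual boundary, i.e. the
lamplighter tends to `+∞`. -/
def IsUpperRay (γ : ℕ → L2) : Prop :=
  IsGeodesicRay γ ∧ γ 0 = 1 ∧ Tendsto (fun n => (γ n).height) atTop atTop

/-- `γ` is a geodesic ray from the identity whose class lies in the lower visual boundary, i.e. the
lamplighter tends to `-∞`. -/
def IsLowerRay (γ : ℕ → L2) : Prop :=
  IsGeodesicRay γ ∧ γ 0 = 1 ∧ Tendsto (fun n => (γ n).height) atTop atBot

/-- The Busemann function `b^{+,γ}`, for a ray `γ` with set `Λ` of limiting lit lamps. Each of the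
two minima involves a finite number, and `Λ` is bounded below for an upper ray, so that `toReal` is
applied to finite values only; likewise below. -/
noncomputable def busemannPos (Λ : Set ℤ) (g : L2) : ℝ :=
  2 * ((min (minPos Λ) 0).toReal
    - (min (minPos (symmDiff Λ (g.lamps : Set ℤ))) (H g : EReal)).toReal) + H g

/-- The Busemann function `b^{-,γ}`, for a ray `γ` with set `Λ` of limiting lit lamps. -/
noncomputable def busemannNeg (Λ : Set ℤ) (g : L2) : ℝ :=
  2 * ((max (maxPos (symmDiff Λ (g.lamps : Set ℤ)) + 1) (H g : EReal)).toReal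
    - (max (maxPos Λ + 1) 0).toReal) - H g

/-- The spine function `s^l`. -/
noncomputable def spine (l : ℤ) (g : L2) : ℝ := |(l : ℝ)| - |(l : ℝ) - H g|

/-- The positive rib function `r^{+,f}`, where `l = H f`. -/
noncomputable def ribPos (f g : L2) : ℝ :=
  2 * ((min (minPos (f.lamps : Set ℤ)) (min (H f : EReal) 0)).toReal
    - (min (minPos (symmDiff (f.lamps : Set ℤ) (g.lamps : Set ℤ)))
        (min (H g : EReal) (H f : EReal))).toReal) + spine f.height g

/-- The negative rib function `r^{-,f}`, where `l = H f`. -/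
noncomputable def ribNeg (f g : L2) : ℝ :=
  2 * ((max (maxPos (symmDiff (f.lamps : Set ℤ) (g.lamps : Set ℤ)) + 1)
        (max (H g : EReal) (H f : EReal))).toReal
    - (max (maxPos (f.lamps : Set ℤ) + 1) (max (H f : EReal) 0)).toReal) + spine f.height g

/-- Left stability: from some index on, all the lamps to the left of some position keep their
status. -/
def LeftStable (g : ℕ → L2) : Prop :=
  ∃ N : ℕ, ∃ K : ℤ, ∀ k < K, ∀ n > N, ∀ n' > N, (k ∈ (g n).lamps ↔ k ∈ (g n').lamps)

/-- Right stability: from some index on, all the lamps to the right of some position keep their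
status. -/
def RightStable (g : ℕ → L2) : Prop :=
  ∃ N : ℕ, ∃ K : ℤ, ∀ k > K, ∀ n > N, ∀ n' > N, (k ∈ (g n).lamps ↔ k ∈ (g n').lamps)

/-- The classification of a horofunction `h` of a sequence `g` whose heights converge to the
integer `l`. -/
def FiniteHeightCases (g : ℕ → L2) (h : L2 → ℝ) (l : ℤ) : Prop :=
  (LeftStable g → RightStable g → ∃ g₀, (∀ᶠ n in atTop, g n = g₀) ∧ h = embed g₀) ∧
  (¬ LeftStable g → ¬ RightStable g → h = spine l) ∧
  (LeftStable g → ¬ RightStable g →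
    ∃ f : L2, f.height = l ∧ maxPos (f.lamps : Set ℤ) < (H f : EReal) ∧ h = ribPos f) ∧
  (¬ LeftStable g → RightStable g →
    ∃ f : L2, f.height = l ∧ (H f : EReal) ≤ minPos (f.lamps : Set ℤ) ∧ h = ribNeg f)

/-- The classification of a horofunction `h` of a sequence `g` whose heights tend to `+∞`. -/
def TopHeightCases (g : ℕ → L2) (h : L2 → ℝ) : Prop :=
  (LeftStable g → ∃ γ Λ, IsUpperRay γ ∧ IsLimitLamps γ Λ ∧ BddBelow Λ ∧
    IsHorofunctionOf γ h ∧ h = busemannPos Λ) ∧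
  (¬ LeftStable g → h = H)

/-- The classification of a horofunction `h` of a sequence `g` whose heights tend to `-∞`. -/
def BotHeightCases (g : ℕ → L2) (h : L2 → ℝ) : Prop :=
  (RightStable g → ∃ γ Λ, IsLowerRay γ ∧ IsLimitLamps γ Λ ∧ BddAbove Λ ∧
    IsHorofunctionOf γ h ∧ h = busemannNeg Λ) ∧
  (¬ RightStable g → h = -H)

end Lamplighter

namespace Lamplighter

/-! Each generator crosses one edge of the line and can toggle only the lamp at the left end of that
edge. A path from `z` to `x` must therefore cover an interval that contains both lamplighters and,
for each lamp `k` in which `z` and `x` differ, the edge from `k` to `k + 1`. The shortest such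
interval is `[lo z x, hi z x]`. An optimal path crosses its edges between the two heights once and
the others twice, which gives `d_eq`. Hence `embed z x` is a sum of a left term in `lo`, a right
term in `hi` and a spine term in the heights (`embed_eq`).

The values of `embed` are integers, so pointwise convergence means eventual equality at each point.
The change of `embed z` under a step of `x` from `j` to `j + 1` is a yes-or-no test on `z`: it tells
on which side of `j` the lamplighter is, and whether all lamps on the far side of `j` from the
lamplighter agree with a given finite set. Along a convergent sequence every such test settles. So
the heights become constant or diverge (`height_cases`). The lamps on a side not taken over by the
lamplighter behave in one of two ways: a stable side freezes on each fixed half-line, by a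
finiteness argument (`exists_agree_left`, `exists_agree_right`); an unstable side eventually has lit
lamps beyond any given position, and its term cancels (`lo_eq_lo_one`, `hi_eq_hi_one`). A
lamplighter escaping to one side also cancels that side's term. The eight cases are the
combinations.

All boundary points other than the Busemann points produced here are indexed by `ℤ`, by two copies
of `L2`, or are `H` and `-H`, so they are countably many. -/

/-- The interval `[L, U]` contains `0`, the lamplighter, and for each lit lamp `k` the edge from `k`
to `k + 1`. -/
structure Spans (g : L2) (L U : ℤ) : Prop where
  left_zero : L ≤ 0
  left_height : L ≤ g.height
  left_lamps : ∀ k ∈ g.lamps, L ≤ k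
  right_zero : 0 ≤ U
  right_height : g.height ≤ U
  right_lamps : ∀ k ∈ g.lamps, k < U

/-! ### Word length as the cost of covering an interval -/

theorem height_t : t.height = 1 := rfl

theorem height_a : a.height = 0 := rfl

theorem height_at : (a * t).height = 1 := rfl

theorem mem_lamps_mul_t (g : L2) (k : ℤ) : k ∈ (g * t).lamps ↔ k ∈ g.lamps := by
  simp [mem_lamps_mul, t]

theorem mem_lamps_mul_at (g : L2) (k : ℤ) :
    k ∈ (g * (a * t)).lamps ↔ (k ∈ g.lamps ↔ k ≠ g.height) := by
  simp only [mem_lamps_mul, t, a, Finset.notMem_empty, Finset.mem_singleton]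
  grind

theorem mem_lamps_mul_t_inv (g : L2) (k : ℤ) : k ∈ (g * t⁻¹).lamps ↔ k ∈ g.lamps := by
  simp [mem_lamps_mul, mem_lamps_inv, t]

theorem mem_lamps_mul_at_inv (g : L2) (k : ℤ) :
    k ∈ (g * (a * t)⁻¹).lamps ↔ (k ∈ g.lamps ↔ k ≠ g.height - 1) := by
  simp only [mem_lamps_mul, mem_lamps_inv, height_at]
  simp only [t, a, Finset.notMem_empty, Finset.mem_singleton]
  grind

/-- Lower bound for the word length. If a step enlarges the interval, it also moves the lamplighter
away from `0`, so the cost grows by `2 - 1`; if not, only `|height|` changes, by one. -/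
theorem exists_spans_of_word (w : List L2) (hw : ∀ x ∈ w, x ∈ gens ∨ x⁻¹ ∈ gens) :
    ∃ L U, Spans w.prod L U ∧ 2 * (U - L) - |w.prod.height| ≤ w.length := by
  induction w using List.reverseRecOn with
  | nil => exact ⟨0, 0, by constructor <;> simp [lamps_one, height_one], by simp [height_one]⟩
  | append_singleton w s ih =>
    obtain ⟨L, U, h, hn⟩ := ih fun x hx => hw x (by simp [hx])
    obtain ⟨h1, h2, h3, h4, h5, h6⟩ := h
    have hs := hw s (by simp)
    simp only [List.prod_append, List.prod_singleton, List.length_append, List.length_singleton]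
    set g := w.prod
    have hcase : (s.height = 1 ∧ ∀ k ∈ (g * s).lamps, k ∈ g.lamps ∨ k = g.height) ∨
        (s.height = -1 ∧ ∀ k ∈ (g * s).lamps, k ∈ g.lamps ∨ k = g.height - 1) := by
      simp only [gens, Set.mem_insert_iff, Set.mem_singleton_iff] at hs
      rcases hs with (rfl | rfl) | hs | hs
      · exact .inl ⟨rfl, fun k => by rw [mem_lamps_mul_t]; grind⟩
      · exact .inl ⟨rfl, fun k => by rw [mem_lamps_mul_at]; grind⟩
      · obtain rfl : s = t⁻¹ := by rw [← hs, inv_inv]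
        exact .inr ⟨rfl, fun k => by rw [mem_lamps_mul_t_inv]; grind⟩
      · obtain rfl : s = (a * t)⁻¹ := by rw [← hs, inv_inv]
        exact .inr ⟨rfl, fun k => by rw [mem_lamps_mul_at_inv]; grind⟩
    rcases hcase with ⟨hh, hl⟩ | ⟨hh, hl⟩
    · refine ⟨L, max U (g.height + 1), ⟨h1, ?_, ?_, ?_, ?_, ?_⟩, ?_⟩ <;>
        (try simp only [height_mul, hh]) <;> grind
    · refine ⟨min L (g.height - 1), U, ⟨?_, ?_, ?_, h4, ?_, ?_⟩, ?_⟩ <;>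
        (try simp only [height_mul, hh]) <;> grind

/-- Upper bound, by undoing a path from its end: some generator lowers the cost by one. The
lamplighter moves outwards to the end of the interval on its side of `0`; there it turns back,
switches off the outermost lamp if lit, and the interval loses an edge. -/
theorem exists_word_of_spans (n : ℕ) (g : L2) (L U : ℤ) (h : Spans g L U)
    (hn : 2 * (U - L) - |g.height| = n) :
    ∃ w : List L2, w.length = n ∧ (∀ x ∈ w, x ∈ gens ∨ x⁻¹ ∈ gens) ∧ w.prod = g := by
  induction n generalizing g L U with
  | zero =>
    obtain ⟨h1, h2, h3, h4, h5, h6⟩ := h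
    refine ⟨[], rfl, by simp, ?_⟩
    ext k
    · simp only [List.prod_nil, lamps_one, Finset.notMem_empty, false_iff]
      grind
    · simp only [List.prod_nil, height_one]
      grind
  | succ n ih =>
    suffices hstep : ∃ s L' U', (s ∈ gens ∨ s⁻¹ ∈ gens) ∧ Spans (g * s) L' U' ∧
        2 * (U' - L') - |(g * s).height| = n by
      obtain ⟨s, L', U', hs, h', hn'⟩ := hstep
      obtain ⟨w, rfl, hw, hp⟩ := ih _ L' U' h' hn'
      refine ⟨w ++ [s⁻¹], by simp, ?_, by simp [hp]⟩
      intro x hx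
      rcases List.mem_append.1 hx with hx | hx
      · exact hw x hx
      · rw [List.mem_singleton.1 hx, inv_inv]
        exact hs.symm
    have move_right (h5 : g.height < U) (h0 : 0 ≤ g.height) : ∃ s L' U',
        (s ∈ gens ∨ s⁻¹ ∈ gens) ∧ Spans (g * s) L' U' ∧
          2 * (U' - L') - |(g * s).height| = n := by
      obtain ⟨h1, h2, h3, h4, -, h6⟩ := h
      refine ⟨t, L, U, .inl (by simp [gens]), ⟨h1, ?_, ?_, h4, ?_, ?_⟩, ?_⟩ <;>
        (try simp only [height_mul, height_t, mem_lamps_mul_t]) <;> grind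
    have move_left (h5 : L < g.height) (h0 : g.height ≤ 0) : ∃ s L' U',
        (s ∈ gens ∨ s⁻¹ ∈ gens) ∧ Spans (g * s) L' U' ∧
          2 * (U' - L') - |(g * s).height| = n := by
      obtain ⟨h1, -, h3, h4, h5, h6⟩ := h
      refine ⟨t⁻¹, L, U, .inr (by simp [gens]), ⟨h1, ?_, ?_, h4, ?_, ?_⟩, ?_⟩ <;>
        (try simp only [height_mul, height_inv, height_t, mem_lamps_mul_t_inv]) <;> grind
    obtain ⟨h1, h2, h3, h4, h5, h6⟩ := h
    rcases lt_trichotomy g.height 0 with h0 | h0 | h0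
    · rcases h2.lt_or_eq with h2 | h2
      · exact move_left h2 h0.le
      · by_cases hm : g.height ∈ g.lamps
        · refine ⟨a * t, L + 1, U, .inl (by simp [gens]), ⟨?_, ?_, ?_, h4, ?_, ?_⟩, ?_⟩ <;>
            (try simp only [height_mul, height_a, height_t, mem_lamps_mul_at]) <;> grind
        · refine ⟨t, L + 1, U, .inl (by simp [gens]), ⟨?_, ?_, ?_, h4, ?_, ?_⟩, ?_⟩ <;>
            (try simp only [height_mul, height_t, mem_lamps_mul_t]) <;> grind
    · rcases h5.lt_or_eq with h5 | h5
      · exact move_right h5 h0.ge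
      -- Here `U = 0`, and the positive cost forces `L < 0`.
      · exact move_left (by grind) h0.le
    · rcases h5.lt_or_eq with h5 | h5
      · exact move_right h5 h0.le
      · by_cases hm : g.height - 1 ∈ g.lamps
        · refine ⟨(a * t)⁻¹, L, U - 1, .inr (by simp [gens]), ⟨h1, ?_, ?_, ?_, ?_, ?_⟩, ?_⟩ <;>
            (try simp only [height_mul, height_inv, height_a, height_t, mem_lamps_mul_at_inv]) <;> grind
        · refine ⟨t⁻¹, L, U - 1, .inr (by simp [gens]), ⟨h1, ?_, ?_, ?_, ?_, ?_⟩, ?_⟩ <;>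
            (try simp only [height_mul, height_inv, height_t, mem_lamps_mul_t_inv]) <;> grind

/-! ### The distance formula -/

/-- The left end of the shortest interval that a path from `z` to `x` has to cover. -/
def lo (z x : L2) : ℤ :=
  (insert z.height (insert x.height (symmDiff z.lamps x.lamps))).min' (Finset.insert_nonempty _ _)

/-- The right end of the shortest interval that a path from `z` to `x` has to cover. -/
def hi (z x : L2) : ℤ :=
  (insert z.height (insert x.height ((symmDiff z.lamps x.lamps).image (· + 1)))).max'
    (Finset.insert_nonempty _ _)

theorem le_lo {z x : L2} {c : ℤ} : c ≤ lo z x ↔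
    c ≤ z.height ∧ c ≤ x.height ∧ ∀ k < c, (k ∈ z.lamps ↔ k ∈ x.lamps) := by
  simp only [lo, Finset.le_min'_iff, Finset.mem_insert, forall_eq_or_imp, Finset.mem_symmDiff]
  grind

theorem hi_le {z x : L2} {c : ℤ} : hi z x ≤ c ↔
    z.height ≤ c ∧ x.height ≤ c ∧ ∀ k ≥ c, (k ∈ z.lamps ↔ k ∈ x.lamps) := by
  simp only [hi, Finset.max'_le_iff, Finset.mem_insert, forall_eq_or_imp, Finset.mem_image,
    Finset.mem_symmDiff, forall_exists_index, and_imp,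
    forall_apply_eq_imp_iff₂]
  grind

theorem spans_inv_mul_iff (z x : L2) (L U : ℤ) : Spans (z⁻¹ * x) L U ↔
    L ≤ lo z x - z.height ∧ hi z x - z.height ≤ U := by
  have hm (k : ℤ) : k ∈ (z⁻¹ * x).lamps ↔
      ¬ (k + z.height ∈ z.lamps ↔ k + z.height ∈ x.lamps) := by
    simp only [mem_lamps_mul, mem_lamps_inv, height_inv, sub_neg_eq_add]
    tauto
  rw [le_sub_iff_add_le, sub_le_iff_le_add, le_lo, hi_le]
  constructor
  · rintro ⟨h1, h2, h3, h4, h5, h6⟩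
    simp only [hm, height_mul, height_inv] at *
    have h3' (k : ℤ) := h3 (k - z.height)
    have h6' (k : ℤ) := h6 (k - z.height)
    simp only [sub_add_cancel] at h3' h6'
    refine ⟨⟨by lia, by lia, fun k hk => ?_⟩, by lia, by lia, fun k hk => ?_⟩ <;> grind
  · rintro ⟨⟨h1, h2, h3⟩, h4, h5, h6⟩
    constructor <;> (try simp only [hm, height_mul, height_inv]) <;> grind

theorem d_eq (z x : L2) : (d z x : ℤ) = 2 * (hi z x - lo z x) - |x.height - z.height| := by
  have hH : (z⁻¹ * x).height = x.height - z.height := by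
    rw [height_mul, height_inv]; ring
  have hsp := (spans_inv_mul_iff z x _ _).2 ⟨le_rfl, le_rfl⟩
  have hnn : 0 ≤ 2 * (hi z x - lo z x) - |x.height - z.height| := by
    obtain ⟨h1, h2, h3, h4, h5, h6⟩ := hsp
    rw [hH] at h2 h5
    grind
  obtain ⟨n, hn⟩ := Int.eq_ofNat_of_zero_le hnn
  obtain ⟨w, hw⟩ := exists_word_of_spans n _ _ _ hsp (by rw [hH, ← hn]; ring)
  have hle : d z x ≤ n := Nat.sInf_le ⟨w, hw⟩
  obtain ⟨w', hl, hw', hp⟩ := Nat.sInf_mem (s := {n | ∃ w : List L2, w.length = n ∧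
    (∀ x ∈ w, x ∈ gens ∨ x⁻¹ ∈ gens) ∧ w.prod = z⁻¹ * x}) ⟨n, w, hw⟩
  obtain ⟨L, U, hs, hb⟩ := exists_spans_of_word w' hw'
  rw [hp] at hs hb
  rw [spans_inv_mul_iff] at hs
  have : w'.length = d z x := hl
  rw [hH] at hb
  lia

/-- Separates what depends on the right of `z`, on the left of `z`, and on its height alone; each
part can be taken to the limit independently. -/
theorem embed_eq (z x : L2) : embed z x = 2 * ((hi z x : ℝ) - hi z 1) -
    2 * ((lo z x : ℝ) - lo z 1) + (|(z.height : ℝ)| - |(z.height : ℝ) - x.height|) := by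
  have h1 : ((d z x : ℤ) : ℝ) = ((2 * (hi z x - lo z x) - |x.height - z.height| : ℤ) : ℝ) := by
    rw [d_eq]
  have h2 : ((d z 1 : ℤ) : ℝ) = ((2 * (hi z 1 - lo z 1) - |(1 : L2).height - z.height| : ℤ) : ℝ) :=
    by rw [d_eq]
  push_cast [height_one] at h1 h2
  rw [embed, h1, h2, abs_sub_comm (z.height : ℝ) x.height, zero_sub, abs_neg]
  ring

/-! ### Reading off a lamp stand from horizontal differences -/

/-- A step of `x` to the right brings it closer to `z` or not, according to the position of the
lamplighter and the lamps on one side in which `z` and `x` differ. -/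
theorem embed_step_of_lt {z : L2} {S : Finset ℤ} {j : ℤ} (hj : j < z.height) :
    ((∀ k ≤ j, (k ∈ z.lamps ↔ k ∈ S)) → embed z ⟨S, j + 1⟩ - embed z ⟨S, j⟩ = -1) ∧
    (¬ (∀ k ≤ j, (k ∈ z.lamps ↔ k ∈ S)) → embed z ⟨S, j + 1⟩ - embed z ⟨S, j⟩ = 1) := by
  have hhi : hi z ⟨S, j + 1⟩ = hi z ⟨S, j⟩ :=
    eq_of_forall_ge_iff fun c => by simp only [hi_le]; grind
  have hjR : (j : ℝ) + 1 ≤ z.height := by exact_mod_cast hj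
  have habs : |(z.height : ℝ) - j| - |(z.height : ℝ) - (j + 1)| = 1 := by
    rw [abs_of_nonneg (by linarith), abs_of_nonneg (by linarith)]
    ring
  constructor <;> intro h
  · have h1 : lo z ⟨S, j + 1⟩ = j + 1 :=
      eq_of_forall_le_iff fun c => by simp only [le_lo]; grind
    have h2 : lo z ⟨S, j⟩ = j := eq_of_forall_le_iff fun c => by simp only [le_lo]; grind
    rw [embed_eq, embed_eq, hhi, h1, h2]
    push_cast
    linarith
  · have h1 : lo z ⟨S, j + 1⟩ = lo z ⟨S, j⟩ :=
      eq_of_forall_le_iff fun c => by simp only [le_lo]; grind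
    rw [embed_eq, embed_eq, hhi, h1]
    push_cast
    linarith

theorem embed_step_of_ge {z : L2} {S : Finset ℤ} {j : ℤ} (hj : z.height ≤ j) :
    ((∀ k ≥ j, (k ∈ z.lamps ↔ k ∈ S)) → embed z ⟨S, j + 1⟩ - embed z ⟨S, j⟩ = 1) ∧
    (¬ (∀ k ≥ j, (k ∈ z.lamps ↔ k ∈ S)) → embed z ⟨S, j + 1⟩ - embed z ⟨S, j⟩ = -1) := by
  have hlo : lo z ⟨S, j + 1⟩ = lo z ⟨S, j⟩ :=
    eq_of_forall_le_iff fun c => by simp only [le_lo]; grind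
  have hjR : (z.height : ℝ) ≤ j := by exact_mod_cast hj
  have habs : |(z.height : ℝ) - j| - |(z.height : ℝ) - (j + 1)| = -1 := by
    rw [abs_of_nonpos (by linarith), abs_of_nonpos (by linarith)]
    ring
  constructor <;> intro h
  · have h1 : hi z ⟨S, j + 1⟩ = j + 1 :=
      eq_of_forall_ge_iff fun c => by simp only [hi_le]; grind
    have h2 : hi z ⟨S, j⟩ = j := eq_of_forall_ge_iff fun c => by simp only [hi_le]; grind
    rw [embed_eq, embed_eq, hlo, h1, h2]
    push_cast
    linarith
  · have h1 : hi z ⟨S, j + 1⟩ = hi z ⟨S, j⟩ :=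
      eq_of_forall_ge_iff fun c => by simp only [hi_le]; grind
    rw [embed_eq, embed_eq, hlo, h1]
    push_cast
    linarith

/-- Finitely many steps decide the side of the lamplighter: disagreement gives `1` when it is to the
right of `j` and `-1` otherwise, and one `S` can disagree with both stands at once. -/
theorem lt_height_of_embed_step_eq {z z' : L2} {j : ℤ}
    (h : ∀ S ⊆ ({j - 1, j} : Finset ℤ),
      embed z ⟨S, j + 1⟩ - embed z ⟨S, j⟩ = embed z' ⟨S, j + 1⟩ - embed z' ⟨S, j⟩)
    (hz : j < z.height) : j < z'.height := by
  by_contra hz'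
  -- `S` differs from `z` at `j - 1`, which the left test sees, and from `z'` at `j`, which the
  -- right test sees.
  let S : Finset ℤ := ({j - 1, j} : Finset ℤ).filter fun k =>
    (k = j ∧ j ∉ z'.lamps) ∨ (k = j - 1 ∧ j - 1 ∉ z.lamps)
  have h1 := (embed_step_of_lt (S := S) hz).2 fun hall => by
    have := hall (j - 1) (by lia)
    simp [S] at this
  have h2 := (embed_step_of_ge (S := S) (not_lt.1 hz')).2 fun hall => by
    have := hall j le_rfl
    simp [S] at this
    grind
  have h3 := h S (Finset.filter_subset _ _)
  rw [h1, h2] at h3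
  norm_num at h3

/-! ### What convergence forces on a sequence -/

section Sequences

variable {g : ℕ → L2} {h : L2 → ℝ}

theorem IsHorofunctionOf.eventually_eq (hg : IsHorofunctionOf g h) (x : L2) :
    ∀ᶠ n in atTop, embed (g n) x = h x := by
  have hcast (n : ℕ) : embed (g n) x = (((d (g n) x : ℤ) - d (g n) 1 : ℤ) : ℝ) := by
    simp [embed]
  have hx : Tendsto (fun n => (((d (g n) x : ℤ) - d (g n) 1 : ℤ) : ℝ)) atTop (𝓝 (h x)) :=
    (hg x).congr fun n => hcast n
  -- The integers are closed and discrete in `ℝ`: the limit is an integer and is eventually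
  -- attained.
  obtain ⟨m, hm⟩ := Int.isClosedEmbedding_coe_real.isClosed_range.mem_of_tendsto hx
    (Eventually.of_forall fun n => Set.mem_range_self _)
  rw [← hm] at hx
  have hx' := Int.isClosedEmbedding_coe_real.isEmbedding.tendsto_nhds_iff.2 hx
  rw [nhds_discrete, tendsto_pure] at hx'
  filter_upwards [hx'] with n hn
  rw [hcast, hn, ← hm]

theorem isHorofunctionOf_of_eventually_eq (hg : ∀ x, ∀ᶠ n in atTop, embed (g n) x = h x) :
    IsHorofunctionOf g h := fun x =>
  tendsto_const_nhds.congr' ((hg x).mono fun _ hn => hn.symm)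

theorem IsHorofunctionOf.unique {h' : L2 → ℝ} (hg : IsHorofunctionOf g h)
    (hg' : IsHorofunctionOf g h') : h = h' :=
  funext fun x => tendsto_nhds_unique (hg x) (hg' x)

theorem IsHorofunctionOf.eventually_step_eq (hg : IsHorofunctionOf g h) (S : Finset ℤ) (j : ℤ) :
    ∀ᶠ n in atTop,
      embed (g n) ⟨S, j + 1⟩ - embed (g n) ⟨S, j⟩ = h ⟨S, j + 1⟩ - h ⟨S, j⟩ := by
  filter_upwards [hg.eventually_eq ⟨S, j + 1⟩, hg.eventually_eq ⟨S, j⟩] with n h1 h2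
  rw [h1, h2]

theorem IsHorofunctionOf.eventually_lt_height_or (hg : IsHorofunctionOf g h) (j : ℤ) :
    (∀ᶠ n in atTop, j < (g n).height) ∨ ∀ᶠ n in atTop, (g n).height ≤ j := by
  have hev := (Filter.eventually_all_finset ({j - 1, j} : Finset ℤ).powerset).2
    fun S _ => hg.eventually_step_eq S j
  obtain ⟨N, hN⟩ := eventually_atTop.1 hev
  have hstep {m n : ℕ} (hm : N ≤ m) (hn : N ≤ n) (hj : j < (g m).height) : j < (g n).height :=
    lt_height_of_embed_step_eq (fun S hS => by
      rw [hN m hm S (Finset.mem_powerset.2 hS), hN n hn S (Finset.mem_powerset.2 hS)]) hj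
  rcases lt_or_ge j (g N).height with hj | hj
  · exact .inl (eventually_atTop.2 ⟨N, fun n hn => hstep le_rfl hn hj⟩)
  · exact .inr (eventually_atTop.2 ⟨N, fun n hn => not_lt.1 fun hlt =>
      absurd (hstep hn le_rfl hlt) (not_lt.2 hj)⟩)

theorem IsHorofunctionOf.height_cases (hg : IsHorofunctionOf g h) :
    (∃ l : ℤ, ∀ᶠ n in atTop, (g n).height = l) ∨
      Tendsto (fun n => (g n).height) atTop atTop ∨
      Tendsto (fun n => (g n).height) atTop atBot := by
  by_cases htop : ∀ j, ∀ᶠ n in atTop, j < (g n).height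
  · exact .inr (.inl (tendsto_atTop.2 fun j => (htop j).mono fun _ hn => hn.le))
  by_cases hbot : ∀ j, ∀ᶠ n in atTop, (g n).height ≤ j
  · exact .inr (.inr (tendsto_atBot.2 hbot))
  obtain ⟨j, hj⟩ := not_forall.1 htop
  obtain ⟨i, hi⟩ := not_forall.1 hbot
  have hj' := (hg.eventually_lt_height_or j).resolve_left hj
  have hi' := (hg.eventually_lt_height_or i).resolve_right hi
  -- `l` is the least eventual upper bound of the heights. As `l - 1` is not one, the dichotomy puts
  -- the heights eventually above `l - 1`.
  obtain ⟨l, hl, hleast⟩ := Int.exists_least_of_bdd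
    (P := fun k => ∀ᶠ n in atTop, (g n).height ≤ k)
    ⟨i, fun k hk => by
      obtain ⟨n, h1, h2⟩ := (hk.and hi').exists
      lia⟩ ⟨j, hj'⟩
  refine .inl ⟨l, ?_⟩
  have hl' := (hg.eventually_lt_height_or (l - 1)).resolve_right fun hk => by
    have := hleast _ hk
    lia
  filter_upwards [hl, hl'] with n h1 h2
  lia

theorem IsHorofunctionOf.eventually_agree_left_or (hg : IsHorofunctionOf g h) {j : ℤ}
    (hj : ∀ᶠ n in atTop, j < (g n).height) (S : Finset ℤ) :
    (∀ᶠ n in atTop, ∀ k ≤ j, (k ∈ (g n).lamps ↔ k ∈ S)) ∨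
      ∀ᶠ n in atTop, ¬ ∀ k ≤ j, (k ∈ (g n).lamps ↔ k ∈ S) := by
  have hev := (hg.eventually_step_eq S j).and hj
  by_cases hS : h ⟨S, j + 1⟩ - h ⟨S, j⟩ = 1
  · refine .inr (hev.mono fun n hn hall => ?_)
    have := (embed_step_of_lt hn.2).1 hall
    linarith [hn.1]
  · refine .inl (hev.mono fun n hn => by_contra fun hall => hS ?_)
    rw [← hn.1, (embed_step_of_lt hn.2).2 hall]

theorem IsHorofunctionOf.eventually_agree_right_or (hg : IsHorofunctionOf g h) {j : ℤ}
    (hj : ∀ᶠ n in atTop, (g n).height ≤ j) (S : Finset ℤ) :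
    (∀ᶠ n in atTop, ∀ k ≥ j, (k ∈ (g n).lamps ↔ k ∈ S)) ∨
      ∀ᶠ n in atTop, ¬ ∀ k ≥ j, (k ∈ (g n).lamps ↔ k ∈ S) := by
  have hev := (hg.eventually_step_eq S j).and hj
  by_cases hS : h ⟨S, j + 1⟩ - h ⟨S, j⟩ = -1
  · refine .inr (hev.mono fun n hn hall => ?_)
    have := (embed_step_of_ge hn.2).1 hall
    linarith [hn.1]
  · refine .inl (hev.mono fun n hn => by_contra fun hall => hS ?_)
    rw [← hn.1, (embed_step_of_ge hn.2).2 hall]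

/-- Testing against the empty set suffices: lamps eventually all off far to the left would make the
sequence left stable. -/
theorem IsHorofunctionOf.eventually_exists_lt_mem (hg : IsHorofunctionOf g h) {j : ℤ}
    (hj : ∀ᶠ n in atTop, j < (g n).height) (hs : ¬ LeftStable g) (C : ℤ) :
    ∀ᶠ n in atTop, ∃ k < C, k ∈ (g n).lamps := by
  rcases hg.eventually_agree_left_or (j := min j (C - 1))
    (hj.mono fun n hn => min_lt_of_left_lt hn) ∅ with hag | hag
  · obtain ⟨N, hN⟩ := eventually_atTop.1 hag
    refine absurd ⟨N, min j (C - 1), fun k hk n hn n' hn' => ?_⟩ hs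
    rw [hN n hn.le k hk.le, hN n' hn'.le k hk.le]
  · filter_upwards [hag] with n hn
    push Not at hn
    obtain ⟨k, hk, hk'⟩ := hn
    exact ⟨k, by lia, by simpa using hk'⟩

theorem IsHorofunctionOf.eventually_exists_ge_mem (hg : IsHorofunctionOf g h) {j : ℤ}
    (hj : ∀ᶠ n in atTop, (g n).height ≤ j) (hs : ¬ RightStable g) (D : ℤ) :
    ∀ᶠ n in atTop, ∃ k ≥ D, k ∈ (g n).lamps := by
  rcases hg.eventually_agree_right_or (j := max j D)
    (hj.mono fun n hn => le_max_of_le_left hn) ∅ with hag | hag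
  · obtain ⟨N, hN⟩ := eventually_atTop.1 hag
    refine absurd ⟨N, max j D, fun k hk n hn n' hn' => ?_⟩ hs
    rw [hN n hn.le k hk.le, hN n' hn'.le k hk.le]
  · filter_upwards [hag] with n hn
    push Not at hn
    obtain ⟨k, hk, hk'⟩ := hn
    exact ⟨k, by lia, by simpa using hk'⟩

theorem LeftStable.exists_bound (hs : LeftStable g) :
    ∃ C : ℤ, ∀ᶠ n in atTop, ∀ k ∈ (g n).lamps, C ≤ k := by
  obtain ⟨N, K, hK⟩ := hs
  obtain ⟨B, hB⟩ := (g (N + 1)).lamps.bddBelow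
  refine ⟨min B K, eventually_atTop.2 ⟨N + 1, fun n hn k hk => ?_⟩⟩
  by_contra hlt
  have := hB ((hK k (by lia) n (by lia) (N + 1) (by lia)).1 hk)
  lia

theorem RightStable.exists_bound (hs : RightStable g) :
    ∃ D : ℤ, ∀ᶠ n in atTop, ∀ k ∈ (g n).lamps, k ≤ D := by
  obtain ⟨N, K, hK⟩ := hs
  obtain ⟨B, hB⟩ := (g (N + 1)).lamps.bddAbove
  refine ⟨max B K, eventually_atTop.2 ⟨N + 1, fun n hn k hk => ?_⟩⟩
  by_contra hlt
  have := hB ((hK k (by lia) n (by lia) (N + 1) (by lia)).1 hk)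
  lia

/-- Left stability confines the lit lamps up to `j` to a fixed finite window. If each of the
finitely many configurations there were eventually excluded, all would be excluded at once,
including the one that occurs. -/
theorem IsHorofunctionOf.exists_agree_left (hg : IsHorofunctionOf g h) {j : ℤ}
    (hj : ∀ᶠ n in atTop, j < (g n).height) (hs : LeftStable g) :
    ∃ S : Finset ℤ, ∀ᶠ n in atTop, ∀ k ≤ j, (k ∈ (g n).lamps ↔ k ∈ S) := by
  obtain ⟨C, hC⟩ := hs.exists_bound
  by_contra hno
  have hev := (Filter.eventually_all_finset (Finset.Icc C j).powerset).2 fun S _ =>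
    (hg.eventually_agree_left_or hj S).resolve_left (not_exists.1 hno S)
  obtain ⟨n, hn, hnC⟩ := (hev.and hC).exists
  refine hn ((g n).lamps.filter (· ≤ j)) ?_ fun k hk => by simp [hk]
  rw [Finset.mem_powerset]
  intro k hk
  rw [Finset.mem_filter] at hk
  exact Finset.mem_Icc.2 ⟨hnC k hk.1, hk.2⟩

theorem IsHorofunctionOf.exists_agree_right (hg : IsHorofunctionOf g h) {j : ℤ}
    (hj : ∀ᶠ n in atTop, (g n).height ≤ j) (hs : RightStable g) :
    ∃ S : Finset ℤ, ∀ᶠ n in atTop, ∀ k ≥ j, (k ∈ (g n).lamps ↔ k ∈ S) := by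
  obtain ⟨D, hD⟩ := hs.exists_bound
  by_contra hno
  have hev := (Filter.eventually_all_finset (Finset.Icc j D).powerset).2 fun S _ =>
    (hg.eventually_agree_right_or hj S).resolve_left (not_exists.1 hno S)
  obtain ⟨n, hn, hnD⟩ := (hev.and hD).exists
  refine hn ((g n).lamps.filter (j ≤ ·)) ?_ fun k hk => by simp [ge_iff_le.1 hk]
  rw [Finset.mem_powerset]
  intro k hk
  rw [Finset.mem_filter] at hk
  exact Finset.mem_Icc.2 ⟨hk.2, hnD k hk.1⟩

end Sequences

/-! ### Extents: cancellation and translation to `EReal` -/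

/-- A feature of `z` to the left of everything in `x` and in the identity determines the left end
for both, so the left term of `embed_eq` vanishes. -/
theorem lo_eq_lo_one {z x : L2} {C : ℤ} (hx : ∀ k ∈ x.lamps, C ≤ k) (hxC : C ≤ x.height)
    (h0 : C ≤ 0) (hz : z.height ≤ C ∨ ∃ k < C, k ∈ z.lamps) : lo z x = lo z 1 :=
  eq_of_forall_le_iff fun c => by
    simp only [le_lo, lamps_one, height_one, Finset.notMem_empty]
    grind

theorem hi_eq_hi_one {z x : L2} {D : ℤ} (hx : ∀ k ∈ x.lamps, k < D) (hxD : x.height ≤ D)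
    (h0 : 0 ≤ D) (hz : D ≤ z.height ∨ ∃ k ≥ D, k ∈ z.lamps) : hi z x = hi z 1 :=
  eq_of_forall_ge_iff fun c => by
    simp only [hi_le, lamps_one, height_one, Finset.notMem_empty]
    grind

theorem exists_bounds (x : L2) : ∃ C D : ℤ,
    ((∀ k ∈ x.lamps, C ≤ k) ∧ C ≤ x.height ∧ C ≤ 0) ∧
      (∀ k ∈ x.lamps, k < D) ∧ x.height ≤ D ∧ 0 ≤ D :=
  ⟨lo x 1, hi x 1, by
    obtain ⟨h1, h2, h3⟩ := le_lo.1 (le_refl (lo x 1))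
    refine ⟨fun k hk => not_lt.1 fun hlt => ?_, h1, h2⟩
    simpa [lamps_one, hk] using h3 k hlt, by
    obtain ⟨h1, h2, h3⟩ := hi_le.1 (le_refl (hi x 1))
    refine ⟨fun k hk => not_le.1 fun hlt => ?_, h1, h2⟩
    simpa [lamps_one, hk] using h3 k hlt⟩

/-- The integer `μ` is given by its lower bounds, the form in which `le_lo` describes `lo`; the
finite `p` keeps the minimum finite when `B` is empty. -/
theorem min_minPos_eq {B : Set ℤ} {p μ : ℤ} (h : ∀ c, c ≤ μ ↔ c ≤ p ∧ ∀ k < c, k ∉ B) :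
    min (minPos B) ((p : ℝ) : EReal) = ((μ : ℝ) : EReal) := by
  obtain ⟨h1, h2⟩ := (h μ).1 le_rfl
  apply le_antisymm
  · by_cases hp : p ≤ μ
    · exact (min_le_right _ _).trans (by exact_mod_cast hp)
    · have h3 : ¬ (μ + 1 ≤ μ) := by lia
      rw [h] at h3
      push Not at h3
      obtain ⟨k, hk, hkB⟩ := h3 (by lia)
      exact ((min_le_left _ _).trans (iInf₂_le k hkB)).trans
        (by exact_mod_cast (show k ≤ μ by lia))
  · refine le_min (le_iInf₂ fun k hk => ?_) (by exact_mod_cast h1)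
    have : μ ≤ k := not_lt.1 fun hlt => h2 k hlt hk
    exact_mod_cast this

theorem max_maxPos_eq {B : Set ℤ} {p μ : ℤ} (h : ∀ c, μ ≤ c ↔ p ≤ c ∧ ∀ k ≥ c, k ∉ B) :
    max (maxPos B + 1) ((p : ℝ) : EReal) = ((μ : ℝ) : EReal) := by
  obtain ⟨h1, h2⟩ := (h μ).1 le_rfl
  apply le_antisymm
  · refine max_le ?_ (by exact_mod_cast h1)
    have h3 : maxPos B ≤ (((μ - 1 : ℤ) : ℝ) : EReal) := iSup₂_le fun k hk => by
      have : k ≤ μ - 1 := not_lt.1 fun hlt => h2 k (by lia) hk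
      exact_mod_cast this
    refine (add_le_add_left h3 1).trans (le_of_eq ?_)
    rw [← EReal.coe_one, ← EReal.coe_add]
    norm_num
  · by_cases hp : μ ≤ p
    · exact le_trans (by exact_mod_cast hp) (le_max_right _ _)
    · have h3 : ¬ (μ ≤ μ - 1) := by lia
      rw [h] at h3
      push Not at h3
      obtain ⟨k, hk, hkB⟩ := h3 (by lia)
      refine le_trans ?_ ((add_le_add_left (le_iSup₂ (f := fun k (_ : k ∈ B) =>
        ((k : ℝ) : EReal)) k hkB) 1).trans (le_max_left _ _))
      rw [← EReal.coe_one, ← EReal.coe_add]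
      exact_mod_cast (show μ ≤ k + 1 by lia)

/-! ### Reflection and construction of geodesic rays -/

/-- The reflection of the row of lamps that exchanges `t` with `t⁻¹` and `at` with `(at)⁻¹`. -/
def reflect (g : L2) : L2 :=
  ⟨g.lamps.map (Equiv.subLeft (-1)).toEmbedding, -g.height⟩

theorem mem_lamps_reflect (g : L2) (k : ℤ) : k ∈ (reflect g).lamps ↔ -1 - k ∈ g.lamps := by
  rw [reflect, Finset.mem_map_equiv, Equiv.subLeft_symm_apply]
  ring_nf

theorem height_reflect (g : L2) : (reflect g).height = -g.height := rfl

/-- The map `k ↦ -1 - k` on lamps sends the edge from `k` to `k + 1` to its mirror image in `0`, so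
left and right ends are exchanged exactly. -/
theorem lo_reflect (z x : L2) : lo (reflect z) (reflect x) = -hi z x :=
  eq_of_forall_le_iff fun c => by
    rw [le_neg, hi_le, le_lo]
    simp only [mem_lamps_reflect, height_reflect]
    refine and_congr (by lia) (and_congr (by lia) ⟨fun h k hk => ?_, fun h k hk => h _ (by lia)⟩)
    simpa using h (-1 - k) (by lia)

theorem hi_reflect (z x : L2) : hi (reflect z) (reflect x) = -lo z x :=
  eq_of_forall_ge_iff fun c => by
    rw [neg_le, le_lo, hi_le]
    simp only [mem_lamps_reflect, height_reflect]
    refine and_congr (by lia) (and_congr (by lia) ⟨fun h k hk => ?_, fun h k hk => h _ (by lia)⟩)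
    simpa using h (-1 - k) (by lia)

theorem d_reflect (z x : L2) : d (reflect z) (reflect x) = d z x := by
  have h1 := d_eq (reflect z) (reflect x)
  have h2 := d_eq z x
  rw [lo_reflect, hi_reflect, height_reflect, height_reflect] at h1
  grind

theorem isGeodesicRay_of_le {γ : ℕ → L2} (h : ∀ i j : ℕ, i ≤ j → (d (γ i) (γ j) : ℤ) = j - i) :
    IsGeodesicRay γ := by
  have hcomm (z x : L2) : d z x = d x z := by
    have h1 : lo z x = lo x z := eq_of_forall_le_iff fun c => by simp only [le_lo]; grind
    have h2 : hi z x = hi x z := eq_of_forall_ge_iff fun c => by simp only [hi_le]; grind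
    have h3 := d_eq z x
    have h4 := d_eq x z
    rw [h1, h2, abs_sub_comm] at h3
    lia
  intro i j
  rcases le_total i j with hij | hij
  · rw [h i j hij]
    grind
  · rw [hcomm, h j i hij]
    grind

open Classical in
/-- The ray that first goes left to `A ≤ 0` and then right forever, setting the lamps on its way to
their status in `Λ`. -/
noncomputable def rayTo (Λ : Set ℤ) (A : ℤ) (n : ℕ) : L2 :=
  ⟨(Finset.Ico A (n + 2 * A)).filter (· ∈ Λ), |n + A| + A⟩

theorem mem_lamps_rayTo {Λ : Set ℤ} {A : ℤ} {n : ℕ} {k : ℤ} :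
    k ∈ (rayTo Λ A n).lamps ↔ (A ≤ k ∧ k < n + 2 * A) ∧ k ∈ Λ := by
  simp [rayTo]

theorem height_rayTo (Λ : Set ℤ) (A : ℤ) (n : ℕ) : (rayTo Λ A n).height = |n + A| + A := rfl

theorem isGeodesicRay_rayTo {Λ : Set ℤ} {A : ℤ} (hmem : A = 0 ∨ A ∈ Λ) :
    IsGeodesicRay (rayTo Λ A) := by
  refine isGeodesicRay_of_le fun i j hij => ?_
  rw [d_eq, height_rayTo, height_rayTo]
  rcases le_or_gt (j : ℤ) (-A) with hj | hj
  · have h1 : lo (rayTo Λ A i) (rayTo Λ A j) = -j := eq_of_forall_le_iff fun c => by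
      simp only [le_lo, mem_lamps_rayTo, height_rayTo]
      grind
    have h2 : hi (rayTo Λ A i) (rayTo Λ A j) = -i := eq_of_forall_ge_iff fun c => by
      simp only [hi_le, mem_lamps_rayTo, height_rayTo]
      grind
    grind
  · have h2 : hi (rayTo Λ A i) (rayTo Λ A j) = max (|i + A| + A) (|j + A| + A) :=
      eq_of_forall_ge_iff fun c => by
        simp only [hi_le, mem_lamps_rayTo, height_rayTo]
        grind
    rcases le_or_gt (-A) (i : ℤ) with hi | hi
    · have h1 : lo (rayTo Λ A i) (rayTo Λ A j) = i + 2 * A := eq_of_forall_le_iff fun c => by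
        simp only [le_lo, mem_lamps_rayTo, height_rayTo]
        grind
      grind
    -- The turn at `A` lies between the two times. The detour is unavoidable because lamp `A` is lit
    -- after it and not before.
    · have hAΛ : A ∈ Λ := hmem.resolve_left (by lia)
      have h1 : lo (rayTo Λ A i) (rayTo Λ A j) = A := by
        apply le_antisymm
        · by_contra hlt
          have h3 := (le_lo.1 (le_refl (lo (rayTo Λ A i) (rayTo Λ A j)))).2.2 A (by lia)
          simp only [mem_lamps_rayTo] at h3
          grind
        · simp only [le_lo, mem_lamps_rayTo, height_rayTo]
          grind
      grind

theorem exists_upperRay {Λ : Set ℤ} (hΛ : BddBelow Λ) :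
    ∃ γ, IsUpperRay γ ∧ ∀ j : ℤ, ∀ᶠ n in atTop, ∀ k ≤ j, (k ∈ (γ n).lamps ↔ k ∈ Λ) := by
  obtain ⟨A, hA, hmem, hleast⟩ : ∃ A ≤ 0, (A = 0 ∨ A ∈ Λ) ∧ ∀ k ∈ Λ, A ≤ k := by
    obtain ⟨B, hB⟩ := hΛ
    -- `A` is the least element of `Λ ∪ {0}`, so the ray never goes further left than needed.
    obtain ⟨A, hA, hleast⟩ := Int.exists_least_of_bdd (P := fun k => k = 0 ∨ k ∈ Λ)
      ⟨min B 0, fun k hk => hk.elim (fun h => by lia) fun h => (min_le_left _ _).trans (hB h)⟩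
      ⟨0, .inl rfl⟩
    exact ⟨A, hleast 0 (.inl rfl), hA, fun k hk => hleast k (.inr hk)⟩
  refine ⟨rayTo Λ A, ⟨isGeodesicRay_rayTo hmem, ?_, ?_⟩, fun j => ?_⟩
  · ext k
    · simp only [mem_lamps_rayTo, lamps_one, Finset.notMem_empty]
      grind
    · simp only [height_rayTo, height_one]
      grind
  · refine tendsto_atTop.2 fun j => eventually_atTop.2 ⟨(j - 2 * A).toNat, fun n hn => ?_⟩
    rw [height_rayTo]
    grind
  · refine eventually_atTop.2 ⟨(j + 1 - 2 * A).toNat, fun n hn k hk => ?_⟩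
    have := hleast k
    rw [mem_lamps_rayTo]
    grind

theorem exists_lowerRay {Λ : Set ℤ} (hΛ : BddAbove Λ) :
    ∃ γ, IsLowerRay γ ∧ ∀ j : ℤ, ∀ᶠ n in atTop, ∀ k ≥ j, (k ∈ (γ n).lamps ↔ k ∈ Λ) := by
  obtain ⟨B, hB⟩ := hΛ
  obtain ⟨γ, ⟨hgeo, h0, hH⟩, hlim⟩ := exists_upperRay (Λ := {k | -1 - k ∈ Λ})
    ⟨-1 - B, fun k hk => by linarith [hB hk]⟩
  refine ⟨fun n => reflect (γ n), ⟨fun i j => ?_, ?_, tendsto_neg_atTop_atBot.comp hH⟩,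
    fun j => (hlim (-1 - j)).mono fun n hn k hk => ?_⟩
  · rw [d_reflect, hgeo]
  · ext k
    · simp [mem_lamps_reflect, h0, lamps_one]
    · simp [height_reflect, h0, height_one]
  · rw [mem_lamps_reflect, hn _ (by lia)]
    simp

/-! ### Evaluation of the limits, case by case -/

section Limits

variable {g : ℕ → L2} {h : L2 → ℝ}

/-- Only the limiting lamps matter, not the sequence: the right term cancels and the left term
freezes. Applied to the given sequence and to a ray with the same `Λ`, it shows that both have the
same horofunction. -/
theorem isHorofunctionOf_busemannPos {Λ : Set ℤ} (hH : Tendsto (fun n => (g n).height) atTop atTop)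
    (hΛ : ∀ j : ℤ, ∀ᶠ n in atTop, ∀ k ≤ j, (k ∈ (g n).lamps ↔ k ∈ Λ)) :
    IsHorofunctionOf g (busemannPos Λ) :=
  isHorofunctionOf_of_eventually_eq fun x => by
    obtain ⟨C, D, -, hD1, hD2, hD3⟩ := exists_bounds x
    filter_upwards [tendsto_atTop.1 hH D, hΛ D] with n hn hag
    have e1 : min (minPos Λ) 0 = ((lo (g n) 1 : ℝ) : EReal) := by
      have := min_minPos_eq (B := Λ) (p := 0) (μ := lo (g n) 1) fun c => by
        simp only [le_lo, lamps_one, height_one, Finset.notMem_empty]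
        grind
      simpa using this
    have e2 : min (minPos (symmDiff Λ (x.lamps : Set ℤ))) (H x : EReal) =
        ((lo (g n) x : ℝ) : EReal) :=
      min_minPos_eq fun c => by
        simp only [le_lo, Set.mem_symmDiff, Finset.mem_coe]
        grind
    have hnR : (D : ℝ) ≤ (g n).height := by exact_mod_cast hn
    have hxR : (x.height : ℝ) ≤ D := by exact_mod_cast hD2
    have h0R : (0 : ℝ) ≤ D := by exact_mod_cast hD3
    rw [embed_eq, hi_eq_hi_one hD1 hD2 hD3 (.inl hn), busemannPos, e1, e2, EReal.toReal_coe,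
      EReal.toReal_coe, H, abs_of_nonneg (by linarith), abs_of_nonneg (by linarith)]
    ring

theorem isHorofunctionOf_busemannNeg {Λ : Set ℤ} (hH : Tendsto (fun n => (g n).height) atTop atBot)
    (hΛ : ∀ j : ℤ, ∀ᶠ n in atTop, ∀ k ≥ j, (k ∈ (g n).lamps ↔ k ∈ Λ)) :
    IsHorofunctionOf g (busemannNeg Λ) :=
  isHorofunctionOf_of_eventually_eq fun x => by
    obtain ⟨C, D, ⟨hC1, hC2, hC3⟩, -⟩ := exists_bounds x
    filter_upwards [tendsto_atBot.1 hH C, hΛ C] with n hn hag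
    have e1 : max (maxPos Λ + 1) 0 = ((hi (g n) 1 : ℝ) : EReal) := by
      have := max_maxPos_eq (B := Λ) (p := 0) (μ := hi (g n) 1) fun c => by
        simp only [hi_le, lamps_one, height_one, Finset.notMem_empty]
        grind
      simpa using this
    have e2 : max (maxPos (symmDiff Λ (x.lamps : Set ℤ)) + 1) (H x : EReal) =
        ((hi (g n) x : ℝ) : EReal) :=
      max_maxPos_eq fun c => by
        simp only [hi_le, Set.mem_symmDiff, Finset.mem_coe]
        grind
    have hnR : ((g n).height : ℝ) ≤ C := by exact_mod_cast hn
    have hxR : (C : ℝ) ≤ x.height := by exact_mod_cast hC2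
    have h0R : (C : ℝ) ≤ 0 := by exact_mod_cast hC3
    rw [embed_eq, lo_eq_lo_one hC1 hC2 hC3 (.inl hn), busemannNeg, e1, e2, EReal.toReal_coe,
      EReal.toReal_coe, H, abs_of_nonpos (by linarith), abs_of_nonpos (by linarith)]
    ring

theorem topHeightCases (hg : IsHorofunctionOf g h)
    (hH : Tendsto (fun n => (g n).height) atTop atTop) : TopHeightCases g h := by
  have hlt (j : ℤ) : ∀ᶠ n in atTop, j < (g n).height := hH.eventually_gt_atTop j
  refine ⟨fun hs => ?_, fun hs => ?_⟩
  · set Λ : Set ℤ := {k | ∀ᶠ n in atTop, k ∈ (g n).lamps}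
    have hS (j : ℤ) : ∃ S : Finset ℤ, (∀ k ≤ j, (k ∈ Λ ↔ k ∈ S)) ∧
        ∀ᶠ n in atTop, ∀ k ≤ j, (k ∈ (g n).lamps ↔ k ∈ S) := by
      obtain ⟨S, hS⟩ := hg.exists_agree_left (hlt j) hs
      refine ⟨S, fun k hk => ⟨fun hkΛ => ?_, fun hkS => hS.mono fun n hn => (hn k hk).2 hkS⟩, hS⟩
      obtain ⟨n, h1, h2⟩ := (hkΛ.and hS).exists
      exact (h2 k hk).1 h1
    have hlim (j : ℤ) : ∀ᶠ n in atTop, ∀ k ≤ j, (k ∈ (g n).lamps ↔ k ∈ Λ) := by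
      obtain ⟨S, h1, h2⟩ := hS j
      exact h2.mono fun n hn k hk => (hn k hk).trans (h1 k hk).symm
    have hbdd : BddBelow Λ := by
      obtain ⟨S, h1, -⟩ := hS 0
      obtain ⟨B, hB⟩ := S.bddBelow
      refine ⟨min B 0, fun k hk => ?_⟩
      rcases le_total k 0 with h0 | h0
      · exact (min_le_left _ _).trans (hB ((h1 k h0).1 hk))
      · exact (min_le_right _ _).trans h0
    have hh := hg.unique (isHorofunctionOf_busemannPos hH hlim)
    obtain ⟨γ, hγ, hγlim⟩ := exists_upperRay hbdd
    exact ⟨γ, Λ, hγ, fun k => (hγlim k).mono fun n hn => hn k le_rfl, hbdd,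
      hh ▸ isHorofunctionOf_busemannPos hγ.2.2 hγlim, hh⟩
  · refine hg.unique (isHorofunctionOf_of_eventually_eq fun x => ?_)
    obtain ⟨C, D, ⟨hC1, hC2, hC3⟩, hD1, hD2, hD3⟩ := exists_bounds x
    filter_upwards [hlt D, hg.eventually_exists_lt_mem (hlt D) hs C] with n hn hm
    have hnR : (D : ℝ) < (g n).height := by exact_mod_cast hn
    have hxR : (x.height : ℝ) ≤ D := by exact_mod_cast hD2
    have h0R : (0 : ℝ) ≤ D := by exact_mod_cast hD3
    rw [embed_eq, hi_eq_hi_one hD1 hD2 hD3 (.inl hn.le), lo_eq_lo_one hC1 hC2 hC3 (.inr hm), H,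
      abs_of_nonneg (by linarith), abs_of_nonneg (by linarith)]
    ring

theorem botHeightCases (hg : IsHorofunctionOf g h)
    (hH : Tendsto (fun n => (g n).height) atTop atBot) : BotHeightCases g h := by
  have hle (j : ℤ) : ∀ᶠ n in atTop, (g n).height ≤ j := hH.eventually_le_atBot j
  refine ⟨fun hs => ?_, fun hs => ?_⟩
  · set Λ : Set ℤ := {k | ∀ᶠ n in atTop, k ∈ (g n).lamps}
    have hS (j : ℤ) : ∃ S : Finset ℤ, (∀ k ≥ j, (k ∈ Λ ↔ k ∈ S)) ∧
        ∀ᶠ n in atTop, ∀ k ≥ j, (k ∈ (g n).lamps ↔ k ∈ S) := by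
      obtain ⟨S, hS⟩ := hg.exists_agree_right (hle j) hs
      refine ⟨S, fun k hk => ⟨fun hkΛ => ?_, fun hkS => hS.mono fun n hn => (hn k hk).2 hkS⟩, hS⟩
      obtain ⟨n, h1, h2⟩ := (hkΛ.and hS).exists
      exact (h2 k hk).1 h1
    have hlim (j : ℤ) : ∀ᶠ n in atTop, ∀ k ≥ j, (k ∈ (g n).lamps ↔ k ∈ Λ) := by
      obtain ⟨S, h1, h2⟩ := hS j
      exact h2.mono fun n hn k hk => (hn k hk).trans (h1 k hk).symm
    have hbdd : BddAbove Λ := by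
      obtain ⟨S, h1, -⟩ := hS 0
      obtain ⟨B, hB⟩ := S.bddAbove
      refine ⟨max B 0, fun k hk => ?_⟩
      rcases le_total 0 k with h0 | h0
      · exact (hB ((h1 k h0).1 hk)).trans (le_max_left _ _)
      · exact h0.trans (le_max_right _ _)
    have hh := hg.unique (isHorofunctionOf_busemannNeg hH hlim)
    obtain ⟨γ, hγ, hγlim⟩ := exists_lowerRay hbdd
    exact ⟨γ, Λ, hγ, fun k => (hγlim k).mono fun n hn => hn k le_rfl, hbdd,
      hh ▸ isHorofunctionOf_busemannNeg hγ.2.2 hγlim, hh⟩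
  · refine hg.unique (isHorofunctionOf_of_eventually_eq fun x => ?_)
    obtain ⟨C, D, ⟨hC1, hC2, hC3⟩, hD1, hD2, hD3⟩ := exists_bounds x
    filter_upwards [hle C, hg.eventually_exists_ge_mem (hle C) hs D] with n hn hm
    have hnR : ((g n).height : ℝ) ≤ C := by exact_mod_cast hn
    have hxR : (C : ℝ) ≤ x.height := by exact_mod_cast hC2
    have h0R : (C : ℝ) ≤ 0 := by exact_mod_cast hC3
    rw [embed_eq, hi_eq_hi_one hD1 hD2 hD3 (.inr hm), lo_eq_lo_one hC1 hC2 hC3 (.inl hn),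
      Pi.neg_apply, H, abs_of_nonpos (by linarith), abs_of_nonpos (by linarith)]
    ring

theorem finiteHeightCases {l : ℤ} (hg : IsHorofunctionOf g h)
    (hH : ∀ᶠ n in atTop, (g n).height = l) : FiniteHeightCases g h l := by
  have hlt : ∀ᶠ n in atTop, l - 1 < (g n).height := hH.mono fun n hn => by lia
  have hle : ∀ᶠ n in atTop, (g n).height ≤ l := hH.mono fun n hn => hn.le
  refine ⟨fun hL hR => ?_, fun hL hR => ?_, fun hL hR => ?_, fun hL hR => ?_⟩
  · obtain ⟨S, hS⟩ := hg.exists_agree_left hlt hL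
    obtain ⟨T, hT⟩ := hg.exists_agree_right hle hR
    -- The left test covers the lamps up to `l - 1` and the right test those from `l` on, so
    -- together they determine the whole stand.
    have hev : ∀ᶠ n in atTop, g n = ⟨S.filter (· < l) ∪ T.filter (l ≤ ·), l⟩ := by
      filter_upwards [hS, hT, hH] with n h1 h2 h3
      ext k
      · simp only [Finset.mem_union, Finset.mem_filter]
        grind
      · exact h3
    exact ⟨_, hev, hg.unique (isHorofunctionOf_of_eventually_eq fun x =>
      hev.mono fun n hn => by rw [hn])⟩
  · refine hg.unique (isHorofunctionOf_of_eventually_eq fun x => ?_)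
    obtain ⟨C, D, ⟨hC1, hC2, hC3⟩, hD1, hD2, hD3⟩ := exists_bounds x
    filter_upwards [hH, hg.eventually_exists_lt_mem hlt hL C,
      hg.eventually_exists_ge_mem hle hR D] with n hn hm hM
    rw [embed_eq, hi_eq_hi_one hD1 hD2 hD3 (.inr hM), lo_eq_lo_one hC1 hC2 hC3 (.inr hm), hn,
      spine, H]
    ring
  · obtain ⟨S, hS⟩ := hg.exists_agree_left hlt hL
    refine ⟨⟨S.filter (· < l), l⟩, rfl, ?_, ?_⟩
    -- Strictness does not pass to a supremum by itself; integrality supplies the uniform bound `l -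
    -- 1`.
    · refine lt_of_le_of_lt (b := (((l - 1 : ℤ) : ℝ) : EReal)) (iSup₂_le fun k hk => ?_) ?_
      · have : k ≤ l - 1 := Int.le_sub_one_of_lt (Finset.mem_filter.1 hk).2
        exact_mod_cast this
      · simp only [H]
        exact_mod_cast sub_one_lt l
    · refine hg.unique (isHorofunctionOf_of_eventually_eq fun x => ?_)
      obtain ⟨C, D, -, hD1, hD2, hD3⟩ := exists_bounds x
      filter_upwards [hH, hS, hg.eventually_exists_ge_mem hle hR D] with n hn hag hM
      have e1 : min (minPos ((S.filter (· < l) : Finset ℤ) : Set ℤ)) (min ((l : ℝ) : EReal) 0) =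
          ((lo (g n) 1 : ℝ) : EReal) := by
        have := min_minPos_eq (B := ((S.filter (· < l) : Finset ℤ) : Set ℤ)) (p := min l 0)
          (μ := lo (g n) 1) fun c => by
            simp only [le_lo, lamps_one, height_one, Finset.notMem_empty, Finset.mem_coe,
              Finset.mem_filter]
            grind
        simpa [EReal.coe_strictMono.monotone.map_min] using this
      have e2 : min (minPos (symmDiff ((S.filter (· < l) : Finset ℤ) : Set ℤ) (x.lamps : Set ℤ)))
          (min ((x.height : ℝ) : EReal) ((l : ℝ) : EReal)) = ((lo (g n) x : ℝ) : EReal) := by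
        have := min_minPos_eq
          (B := symmDiff ((S.filter (· < l) : Finset ℤ) : Set ℤ) (x.lamps : Set ℤ))
          (p := min x.height l) (μ := lo (g n) x) fun c => by
            simp only [le_lo, Set.mem_symmDiff, Finset.mem_coe, Finset.mem_filter]
            grind
        simpa [EReal.coe_strictMono.monotone.map_min] using this
      rw [embed_eq, hi_eq_hi_one hD1 hD2 hD3 (.inr hM), hn, ribPos]
      simp only [H, spine]
      rw [e1, e2, EReal.toReal_coe, EReal.toReal_coe]
      ring
  · obtain ⟨S, hS⟩ := hg.exists_agree_right hle hR
    refine ⟨⟨S.filter (l ≤ ·), l⟩, rfl, ?_, ?_⟩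
    · refine le_iInf₂ fun k hk => ?_
      have : l ≤ k := (Finset.mem_filter.1 hk).2
      simp only [H]
      exact_mod_cast this
    · refine hg.unique (isHorofunctionOf_of_eventually_eq fun x => ?_)
      obtain ⟨C, D, ⟨hC1, hC2, hC3⟩, -⟩ := exists_bounds x
      filter_upwards [hH, hS, hg.eventually_exists_lt_mem hlt hL C] with n hn hag hm
      have e1 : max (maxPos ((S.filter (l ≤ ·) : Finset ℤ) : Set ℤ) + 1)
          (max ((l : ℝ) : EReal) 0) = ((hi (g n) 1 : ℝ) : EReal) := by
        have := max_maxPos_eq (B := ((S.filter (l ≤ ·) : Finset ℤ) : Set ℤ)) (p := max l 0)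
          (μ := hi (g n) 1) fun c => by
            simp only [hi_le, lamps_one, height_one, Finset.notMem_empty, Finset.mem_coe,
              Finset.mem_filter]
            grind
        simpa [EReal.coe_strictMono.monotone.map_max] using this
      have e2 : max (maxPos (symmDiff ((S.filter (l ≤ ·) : Finset ℤ) : Set ℤ)
          (x.lamps : Set ℤ)) + 1) (max ((x.height : ℝ) : EReal) ((l : ℝ) : EReal)) =
          ((hi (g n) x : ℝ) : EReal) := by
        have := max_maxPos_eq
          (B := symmDiff ((S.filter (l ≤ ·) : Finset ℤ) : Set ℤ) (x.lamps : Set ℤ))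
          (p := max x.height l) (μ := hi (g n) x) fun c => by
            simp only [hi_le, Set.mem_symmDiff, Finset.mem_coe, Finset.mem_filter]
            grind
        simpa [EReal.coe_strictMono.monotone.map_max] using this
      rw [embed_eq, lo_eq_lo_one hC1 hC2 hC3 (.inr hm), hn, ribNeg]
      simp only [H, spine]
      rw [e1, e2, EReal.toReal_coe, EReal.toReal_coe]
      ring

end Limits

/-! ### Assembling the classification; countability -/

instance : Countable L2 :=
  Function.Injective.countable (f := fun g : L2 => (g.lamps, g.height)) fun g g' h => by
    simp only [Prod.mk.injEq] at h
    exact L2.ext h.1 h.2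

theorem exists_isHorofunctionOf {h : L2 → ℝ} (hh : h ∈ horofunctions) :
    ∃ g : ℕ → L2, IsHorofunctionOf g h := by
  obtain ⟨u, hu, hlim⟩ := mem_closure_iff_seq_limit.1 hh
  choose g hg using hu
  refine ⟨g, fun x => ((tendsto_pi_nhds.1 hlim) x).congr fun n => ?_⟩
  rw [← hg n, embed]

/-- The classification of the horofunctions of a sequence, by its heights and its stability. -/
theorem classification {g : ℕ → L2} {h : L2 → ℝ} (hg : IsHorofunctionOf g h) :
    (∃ l : ℤ, Tendsto (fun n => (g n).height) atTop (𝓝 l) ∧ FiniteHeightCases g h l) ∨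
      (Tendsto (fun n => (g n).height) atTop atTop ∧ TopHeightCases g h) ∨
      (Tendsto (fun n => (g n).height) atTop atBot ∧ BotHeightCases g h) := by
  rcases hg.height_cases with ⟨l, hl⟩ | hH | hH
  · exact .inl ⟨l, tendsto_const_nhds.congr' (hl.mono fun n hn => hn.symm),
      finiteHeightCases hg hl⟩
  · exact .inr (.inl ⟨hH, topHeightCases hg hH⟩)
  · exact .inr (.inr ⟨hH, botHeightCases hg hH⟩)

theorem horoboundary_cases {h : L2 → ℝ} (hh : h ∈ horoboundary) :
    (IsBusemannPoint h ∧ ∃ γ Λ, IsLimitLamps γ Λ ∧ IsHorofunctionOf γ h ∧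
      ((IsUpperRay γ ∧ BddBelow Λ ∧ h = busemannPos Λ) ∨
        (IsLowerRay γ ∧ BddAbove Λ ∧ h = busemannNeg Λ))) ∨
    (∃ l : ℤ, h = spine l) ∨
    (∃ f : L2, maxPos (f.lamps : Set ℤ) < (H f : EReal) ∧ h = ribPos f) ∨
    (∃ f : L2, (H f : EReal) ≤ minPos (f.lamps : Set ℤ) ∧ h = ribNeg f) ∨
    h = H ∨ h = -H := by
  obtain ⟨g, hg⟩ := exists_isHorofunctionOf hh.1
  rcases classification hg with ⟨l, -, h1, h2, h3, h4⟩ | ⟨-, h1, h2⟩ | ⟨-, h1, h2⟩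
  · by_cases hL : LeftStable g <;> by_cases hR : RightStable g
    · obtain ⟨g₀, -, rfl⟩ := h1 hL hR
      exact absurd (Set.mem_range_self g₀) hh.2
    · obtain ⟨f, -, hf⟩ := h3 hL hR
      exact .inr (.inr (.inl ⟨f, hf⟩))
    · obtain ⟨f, -, hf⟩ := h4 hL hR
      exact .inr (.inr (.inr (.inl ⟨f, hf⟩)))
    · exact .inr (.inl ⟨l, h2 hL hR⟩)
  · by_cases hL : LeftStable g
    · obtain ⟨γ, Λ, hγ, hlim, hb, hγh, he⟩ := h1 hL
      exact .inl ⟨⟨hh, γ, hγ.1, hγh⟩, γ, Λ, hlim, hγh, .inl ⟨hγ, hb, he⟩⟩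
    · exact .inr (.inr (.inr (.inr (.inl (h2 hL)))))
  · by_cases hR : RightStable g
    · obtain ⟨γ, Λ, hγ, hlim, hb, hγh, he⟩ := h1 hR
      exact .inl ⟨⟨hh, γ, hγ.1, hγh⟩, γ, Λ, hlim, hγh, .inr ⟨hγ, hb, he⟩⟩
    · exact .inr (.inr (.inr (.inr (.inr (h2 hR)))))

theorem countable_not_isBusemannPoint :
    {h | h ∈ horoboundary ∧ ¬ IsBusemannPoint h}.Countable := by
  refine (((Set.countable_range spine).union ((Set.countable_range ribPos).union
    (Set.countable_range ribNeg))).union (Set.toFinite {H, -H}).countable).mono ?_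
  rintro h ⟨hh, hb⟩
  rcases horoboundary_cases hh with ⟨hb', -⟩ | ⟨l, rfl⟩ | ⟨f, -, rfl⟩ | ⟨f, -, rfl⟩ | rfl | rfl
  · exact absurd hb' hb
  all_goals simp

end Lamplighter

theorem corollary5p12 :
    (∀ h ∈ Lamplighter.horofunctions,
      (∃ g : ℕ → Lamplighter.L2, Lamplighter.IsHorofunctionOf g h) ∧
      ∀ g : ℕ → Lamplighter.L2, Lamplighter.IsHorofunctionOf g h →
        (∃ l : ℤ, Tendsto (fun n => (g n).height) atTop (𝓝 l) ∧
          Lamplighter.FiniteHeightCases g h l) ∨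
        (Tendsto (fun n => (g n).height) atTop atTop ∧ Lamplighter.TopHeightCases g h) ∨
        (Tendsto (fun n => (g n).height) atTop atBot ∧ Lamplighter.BotHeightCases g h)) ∧
    (∀ h ∈ Lamplighter.horoboundary,
      (Lamplighter.IsBusemannPoint h ∧ ∃ γ Λ, Lamplighter.IsLimitLamps γ Λ ∧
        Lamplighter.IsHorofunctionOf γ h ∧
        ((Lamplighter.IsUpperRay γ ∧ BddBelow Λ ∧ h = Lamplighter.busemannPos Λ) ∨
          (Lamplighter.IsLowerRay γ ∧ BddAbove Λ ∧ h = Lamplighter.busemannNeg Λ))) ∨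
      (∃ l : ℤ, h = Lamplighter.spine l) ∨
      (∃ f : Lamplighter.L2,
        Lamplighter.maxPos (f.lamps : Set ℤ) < (Lamplighter.H f : EReal) ∧
          h = Lamplighter.ribPos f) ∨
      (∃ f : Lamplighter.L2,
        (Lamplighter.H f : EReal) ≤ Lamplighter.minPos (f.lamps : Set ℤ) ∧
          h = Lamplighter.ribNeg f) ∨
      h = Lamplighter.H ∨ h = -Lamplighter.H) ∧
    {h | h ∈ Lamplighter.horoboundary ∧ ¬ Lamplighter.IsBusemannPoint h}.Countable := by
  exact ⟨fun h hh => ⟨Lamplighter.exists_isHorofunctionOf hh,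
      fun g hg => Lamplighter.classification hg⟩,
    fun h hh => Lamplighter.horoboundary_cases hh, Lamplighter.countable_not_isBusemannPoint⟩
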